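/- Let $G$ be a Hausdorff topological group acting continuously on a compact Hausdorff space $X$, and assume that the action is minimal (every orbit is dense). Let $d\ge 1$. Notation. For $n\ge 0$ let $\mathcal{HK}^{[n]}\subseteq G^{\{0,1\}^n}$ be the subgroup generated by the elements which are equal to some $h\in G$ on a hyperface $\{\omega:\omega_i=a\}$ ($1\le i\le n$, $a\in\{0,1\}$) and equal to the identity elsewhere. The dynamical cubespace of a system $(G,X)$ is $X$ together with the sets of cubes $C_G^{[n]}(X)=\overline{\{(\gamma(\omega)x)_{\omega}:\gamma\in\mathcal{HK}^{[n]},\,x\in X\}}\subseteq X^{\{0,1\}^n}$, $n\ge 0$. For $k\ge 1$, $\mathrm{NRP}^{[k]}(X)$ is the set of $(x,y)\in X\times X$ such that the configuration on $\{0,1\}^{k+1}$ with value $y$ at $\vec 1=(1,\dots,1)$ and $x$ at every other vertex belongs to $C_G^{[k+1]}(X)$. The system has order $k$ if $k\ge 1$ is the least integer such that $\mathrm{NRP}^{[k]}(X)$ is the diagonal. The cubespace is ergodic if $C_G^{[1]}(X)=X\times X$. It is a nilspace of order $k$ if (i) for every $n\ge 1$, every map $\{0,1\}^n\setminus\{\vec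 1\}\to X$ whose restriction to each face $\{\omega:\omega_i=0\}$ is an $(n-1)$-cube extends to an $n$-cube, and (ii) $k\ge 0$ is the least integer such that any two $(k+1)$-cubes which agree outside $\vec 1$ are equal. "Order at most $d$" means order $k$ for some $k\le d$. A factor map is a continuous surjective $G$-equivariant map between compact Hausdorff spaces with continuous $G$-actions. Theorem. (1) $(G,X)$ is a system of order at most $d$ if and only if its dynamical cubespace is an ergodic nilspace of order at most $d$. (2) $\mathrm{NRP}^{[d]}(X)$ is a closed $G$-invariant equivalence relation, so that $X/\mathrm{NRP}^{[d]}(X)$ is a minimal compact Hausdorff $G$-system and $\pi_d:X\to X/\mathrm{NRP}^{[d]}(X)$ is a factor map. This is the maximal factor of $(G,X)$ which is an ergodic nilspace of order at most $d$: the dynamical cubespace of $X/\mathrm{NRP}^{[d]}(X)$ is an ergodic nilspace of order at most $d$, and for every factor map $\phi:X\to Y$ such that the dynamical cubespace of $(G,Y)$ is an ergodic nilspace of order at most $d$ there is a factor map $\psi:X/\mathrm{NRP}^{[d]}(X)\to Y$ with $\phi=\psi\circ\pi_d$. -/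

import Mathlib

/-! ### Discrete cubes -/

/-- The discrete cube `{0,1}^d`; `false` is `0` and `true` is `1`. -/
abbrev DCube (d : ℕ) : Type := Fin d → Bool

/-- The vertex `(1, …, 1)`. -/
def topVertex (d : ℕ) : DCube d := fun _ => true

/-- The face of codimension one `{ω | ω i = a}`. -/
def hyperface {d : ℕ} (i : Fin d) (a : Bool) : Set (DCube d) := {ω | ω i = a}

/-- Morphisms of discrete cubes: every coordinate of `f ω` is identically `0`, identically `1`,
a coordinate of `ω`, or the negation of a coordinate of `ω`. -/
def IsDCubeMorphism {r k : ℕ} (f : DCube r → DCube k) : Prop :=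
  ∀ j : Fin k, (∀ ω, f ω j = false) ∨ (∀ ω, f ω j = true) ∨
    (∃ i, ∀ ω, f ω j = ω i) ∨ (∃ i, ∀ ω, f ω j = !(ω i))

/-- A vertex with some coordinate equal to `0` is not the vertex `(1, …, 1)`. -/
theorem insertNth_false_ne_topVertex {n : ℕ} (i : Fin (n + 1)) (η : DCube n) :
    (i.insertNth false η : DCube (n + 1)) ≠ topVertex (n + 1) := by
  intro h
  have h' := congrFun h i
  simp [topVertex] at h'

/-! ### Cubespaces and nilspaces -/

/-- A cubespace structure on `X`: closed sets of `d`-cubes for all `d ≥ 0`, with cube invariance.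
(The underlying space of a cubespace is meant to be compact Hausdorff; this is recorded
separately wherever the notion is used.) -/
structure Cubespace (X : Type*) [TopologicalSpace X] where
  cubes : (d : ℕ) → Set (DCube d → X)
  isClosed_cubes : ∀ d, IsClosed (cubes d)
  cube_invariance : ∀ {r k : ℕ} (f : DCube r → DCube k), IsDCubeMorphism f →
    ∀ c ∈ cubes k, c ∘ f ∈ cubes r

namespace Cubespace

variable {X : Type*} [TopologicalSpace X]

/-- Any pair of points forms a `1`-cube. -/
def IsErgodic (C : Cubespace X) : Prop := C.cubes 1 = Set.univ

/-- An `(n+1)`-corner: a map on `{0,1}^{n+1} ∖ {(1, …, 1)}` whose restriction to each face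
`{ω | ω i = 0}` is an `n`-cube. -/
def IsCorner (C : Cubespace X) (n : ℕ)
    (f : {ω : DCube (n + 1) // ω ≠ topVertex (n + 1)} → X) : Prop :=
  ∀ i : Fin (n + 1),
    (fun η : DCube n => f ⟨i.insertNth false η, insertNth_false_ne_topVertex i η⟩) ∈ C.cubes n

/-- `(n+1)`-completion: every `(n+1)`-corner extends to an `(n+1)`-cube. -/
def HasCompletion (C : Cubespace X) (n : ℕ) : Prop :=
  ∀ f : {ω : DCube (n + 1) // ω ≠ topVertex (n + 1)} → X, C.IsCorner n f →
    ∃ c ∈ C.cubes (n + 1), ∀ ω, c ω.1 = f ω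

/-- Fibrant: `d`-completion for every `d ≥ 1`. -/
def IsFibrant (C : Cubespace X) : Prop := ∀ n : ℕ, C.HasCompletion n

/-- `d`-uniqueness: two `d`-cubes which agree outside `(1, …, 1)` are equal. -/
def HasUniqueness (C : Cubespace X) (d : ℕ) : Prop :=
  ∀ c ∈ C.cubes d, ∀ c' ∈ C.cubes d, (∀ ω, ω ≠ topVertex d → c ω = c' ω) → c = c'

/-- A nilspace of order `d`: fibrant, and `d ≥ 0` is the least integer such that
`(d+1)`-uniqueness holds. -/
def IsNilspaceOfOrder (C : Cubespace X) (d : ℕ) : Prop :=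
  C.IsFibrant ∧ IsLeast {k : ℕ | C.HasUniqueness (k + 1)} d

/-- A nilspace of order at most `d`. -/
def IsNilspaceOfOrderAtMost (C : Cubespace X) (d : ℕ) : Prop :=
  ∃ k ≤ d, C.IsNilspaceOfOrder k

end Cubespace

/-! ### The Host-Kra cube group and dynamical cubespaces -/

section Dynamics

/-- The element `[h]_F` of `G^{[d]}`: equal to `h` on `F` and to the identity elsewhere. -/
noncomputable def faceElement {G : Type*} [Group G] {d : ℕ} (F : Set (DCube d)) (h : G) :
    DCube d → G :=
  F.mulIndicator (fun _ => h)

/-- The Host-Kra cube group `HK^{[d]}`: the subgroup of `G^{[d]}` generated by all `[h]_F` with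
`h ∈ G` and `F` a hyperface. -/
def hostKraGroup (G : Type*) [Group G] (d : ℕ) : Subgroup (DCube d → G) :=
  Subgroup.closure
    {γ | ∃ (i : Fin d) (a : Bool) (h : G), γ = faceElement (hyperface i a) h}

variable (G : Type*) [Group G] (X : Type*) [TopologicalSpace X] [MulAction G X]

/-- The configurations `γ x^{[d]}` with `γ ∈ HK^{[d]}` and `x ∈ X`. -/
def hostKraOrbits (d : ℕ) : Set (DCube d → X) :=
  {c | ∃ γ ∈ hostKraGroup G d, ∃ x : X, c = fun ω => γ ω • x}

/-- The dynamical cubes `C_G^{[d]}(X)`. -/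
def dynamicalCubes (d : ℕ) : Set (DCube d → X) := closure (hostKraOrbits G X d)

variable {G} in
/-- Constant elements belong to the Host-Kra group in positive dimension. -/
theorem const_mem_hostKraGroup (n : ℕ) (g : G) :
    (fun _ => g : DCube (n + 1) → G) ∈ hostKraGroup G (n + 1) := by
  have h : (fun _ => g : DCube (n + 1) → G) =
      faceElement (hyperface 0 true) g * faceElement (hyperface 0 false) g := by
    funext ω
    cases hω : ω 0 <;> simp [faceElement, hyperface, Set.mulIndicator, hω]
  rw [h]
  exact mul_mem (Subgroup.subset_closure ⟨0, true, g, rfl⟩)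
    (Subgroup.subset_closure ⟨0, false, g, rfl⟩)

variable {G} in
/-- The Host-Kra groups are compatible with morphisms of discrete cubes. -/
theorem comp_mem_hostKraGroup {n k : ℕ} (f : DCube (n + 1) → DCube k) (hf : IsDCubeMorphism f)
    (γ : DCube k → G) (hγ : γ ∈ hostKraGroup G k) : γ ∘ f ∈ hostKraGroup G (n + 1) := by
  induction hγ using Subgroup.closure_induction with
  | mem γ hγ =>
    obtain ⟨j, a, h, rfl⟩ := hγ
    have hconst : ∀ b : Bool, (∀ ω, f ω j = b) →
        faceElement (hyperface j a) h ∘ f ∈ hostKraGroup G (n + 1) := by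
      intro b hb
      by_cases hab : b = a
      · convert const_mem_hostKraGroup n h using 1
        funext ω
        simp [faceElement, hyperface, Set.mulIndicator, hb, hab]
      · convert one_mem (hostKraGroup G (n + 1)) using 1
        funext ω
        simp [faceElement, hyperface, Set.mulIndicator, hb, hab]
    rcases hf j with h0 | h1 | ⟨i, hi⟩ | ⟨i, hi⟩
    · exact hconst false h0
    · exact hconst true h1
    · refine Subgroup.subset_closure ⟨i, a, h, ?_⟩
      funext ω
      by_cases hω : ω i = a <;> simp [faceElement, hyperface, Set.mulIndicator, hi, hω]
    · refine Subgroup.subset_closure ⟨i, !a, h, ?_⟩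
      funext ω
      cases a <;> cases hω : ω i <;>
        simp [faceElement, hyperface, Set.mulIndicator, hi, hω]
  | one => exact one_mem _
  | mul γ δ _ _ hγ hδ => exact mul_mem hγ hδ
  | inv γ _ hγ => exact inv_mem hγ

/-- Every configuration in `X^{[0]}` is a dynamical cube. -/
theorem mem_dynamicalCubes_zero (c : DCube 0 → X) : c ∈ dynamicalCubes G X 0 := by
  refine subset_closure ⟨1, one_mem _, c default, ?_⟩
  funext ω
  simp [Subsingleton.elim ω default]

/-- The dynamical cubespace `(X, C_G^•)` induced by the action of `G` on `X`. -/
def dynamicalCubespace : Cubespace X where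
  cubes := dynamicalCubes G X
  isClosed_cubes _ := isClosed_closure
  cube_invariance := by
    intro r k f hf c hc
    cases r with
    | zero => exact mem_dynamicalCubes_zero G X _
    | succ n =>
      have hcont : Continuous (fun c : DCube k → X => c ∘ f) :=
        continuous_pi fun ω => continuous_apply (f ω)
      refine map_mem_closure (f := fun c : DCube k → X => c ∘ f) hcont hc ?_
      rintro _ ⟨γ, hγ, x, rfl⟩
      exact ⟨γ ∘ f, comp_mem_hostKraGroup f hf γ hγ, x, rfl⟩

/-! ### Nilpotent regionally proximal relations -/

open Classical in
/-- The lower corner: the configuration equal to `y` at `(1, …, 1)` and to `x` elsewhere. -/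
noncomputable def lowerCorner {X : Type*} (d : ℕ) (x y : X) : DCube d → X :=
  fun ω => if ω = topVertex d then y else x

/-- The nilpotent regionally proximal relation `NRP^{[d]}(X)` of order `d ≥ 1`. -/
def NRP (d : ℕ) : Set (X × X) :=
  {p | lowerCorner (d + 1) p.1 p.2 ∈ dynamicalCubes G X (d + 1)}

/-- A system of order `d`: `d` is the least integer `≥ 1` for which `NRP^{[d]}(X)` is the
diagonal. -/
def IsSystemOfOrder (d : ℕ) : Prop :=
  IsLeast {k : ℕ | 1 ≤ k ∧ NRP G X k = Set.diagonal X} d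

/-- A system of order at most `d`. -/
def IsSystemOfOrderAtMost (d : ℕ) : Prop := ∃ k ≤ d, IsSystemOfOrder G X k

/-- The quotient `X / NRP^{[d]}(X)` with the quotient topology. (`Quot` is the quotient by the
equivalence relation generated by `NRP^{[d]}(X)`, that is, by `NRP^{[d]}(X)` itself when this is
an equivalence relation.) -/
def NRPQuotient (d : ℕ) : Type _ := Quot (fun x y : X => (x, y) ∈ NRP G X d)

/-- The canonical projection `π_d : X → X / NRP^{[d]}(X)`. -/
def nrpProj (d : ℕ) : X → NRPQuotient G X d := Quot.mk _

instance (d : ℕ) : TopologicalSpace (NRPQuotient G X d) :=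
  inferInstanceAs (TopologicalSpace (Quot _))

/-- `NRP^{[d]}(X)` is `G`-invariant. -/
theorem smul_mem_NRP [ContinuousConstSMul G X] (d : ℕ) (g : G) {x y : X}
    (h : (x, y) ∈ NRP G X d) : (g • x, g • y) ∈ NRP G X d := by
  have hcont : Continuous (fun c : DCube (d + 1) → X => fun ω => g • c ω) :=
    continuous_pi fun ω => (continuous_apply ω).const_smul g
  have key : (fun ω => g • lowerCorner (d + 1) x y ω) ∈ dynamicalCubes G X (d + 1) := by
    refine map_mem_closure hcont h ?_
    rintro _ ⟨γ, hγ, z, rfl⟩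
    refine ⟨(fun _ => g) * γ, mul_mem (const_mem_hostKraGroup d g) hγ, z, ?_⟩
    funext ω
    simp [mul_smul]
  have heq : (fun ω => g • lowerCorner (d + 1) x y ω) = lowerCorner (d + 1) (g • x) (g • y) := by
    funext ω
    simp only [lowerCorner]
    split_ifs <;> rfl
  rwa [heq] at key

/-- The induced action on the quotient, `g • [x] = [g • x]`. -/
instance [ContinuousConstSMul G X] (d : ℕ) : MulAction G (NRPQuotient G X d) where
  smul g := Quot.map (fun x => g • x) (fun _ _ h => smul_mem_NRP G X d g h)
  one_smul q := by
    induction q using Quot.ind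
    exact congrArg (Quot.mk _) (one_smul G _)
  mul_smul g h q := by
    induction q using Quot.ind
    exact congrArg (Quot.mk _) (mul_smul g h _)

end Dynamics

/-- A factor map of `G`-systems: a continuous surjective `G`-equivariant map. -/
structure IsFactorMap (G : Type*) [Group G] {X Y : Type*} [TopologicalSpace X] [MulAction G X]
    [TopologicalSpace Y] [MulAction G Y] (φ : X → Y) : Prop where
  continuous : Continuous φ
  surjective : Function.Surjective φ
  map_smul : ∀ (g : G) (x : X), φ (g • x) = g • φ x

universe u v w

/-!
The proof is algebraic and uses Ellis' theory of enveloping semigroups. Let `E` be the enveloping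
semigroup of the minimal system `X` and `E_n` that of the Host-Kra group `HK^{[n]}` acting on
`X^{[n]}`; the elements of `E_n` are families `(p_ω)` of elements of `E`, and `E_n` acts on the
cubes `C_G^{[n]}(X)`, which by minimality form the set `E_n x^{[n]}` for every `x`. If `u` is a
minimal idempotent of `E`, then `U = (u, …, u)` is one of `E_n`
(`IsMinimalIdempotent.pi_const`), so that `U E_n U` is a group. Dividing by a constant family gives
the main tool, `IsMinimalIdempotent.exists_smul_const_eq`: if the cube `c` is fixed by `U` and `b`
is a vertex, there are `r, q ∈ E_n` with `r_b = q_b = u` which take the constant cube `c_b` to `c`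
and `c` to the constant cube `c_b`.

* *Equivalence relation.* Let `x, y, z` be fixed by `u`. If `(x, y) ∈ NRP`, take the corner with
  value `y` at `(1, …, 1)` and `x` elsewhere to the constant cube `y` by such a `q` with `b` the
  vertex `(1, …, 1)`. Then `q` takes the constant cube `x` to the corner with `x` at `(1, …, 1)` and
  `y` elsewhere, so `(y, x) ∈ NRP`. Transitivity is obtained in the same way with `r`. The general
  case follows, because the points of a pair may be replaced by proximal ones
  (`IsMinimalIdempotent.mem_NRP_of_smul_left`): for `w` idempotent, the family equal to the identity
  at `(1, …, 1)` and to `w` elsewhere belongs to `E_n`.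
* *Trivial relation implies nilspace.* If `NRP` is trivial then `u = 1`: the system is distal and
  `E_n` is a group. For two cubes which agree outside `(1, …, 1)`, an element `q` as above makes the
  first one constant and the second one a corner, which yields uniqueness. For completion, a corner
  is made constant on one face `{ω | ω_j = 0}` after the other, by elements of the group which are
  trivial on the faces already treated (`exists_smul_eq_const_of_eq_on_faces`); a constant corner
  has a completion, and the elements used are invertible.
* *Quotient.* A cube of `X / NRP` which is a corner over a pair lifts to a cube `c` of `X` fixed by
  `U`. An element `q` which makes `c` constant takes another constant cube to a cube which is
  coordinatewise equivalent to a corner; as coordinates may be replaced by equivalent ones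
  (`IsMinimalIdempotent.update_mem_dynamicalCubes`), the pair is trivial. Hence `X / NRP` has order
  at most `d`. It is the maximal such factor because factor maps preserve `NRP`, and `NRP` decreases
  with the order.
-/

/-! ### Minimal idempotents in compact right topological monoids -/

/-- The closure of a submonoid `A` of a monoid in which right multiplications are continuous, and
left multiplications by elements of `A` as well, is a submonoid. -/
def Submonoid.rightTopologicalClosure {M : Type*} [Monoid M] [TopologicalSpace M]
    (A : Submonoid M) (hR : ∀ r : M, Continuous (· * r)) (hL : ∀ a ∈ A, Continuous (a * ·)) :
    Submonoid M where
  carrier := _root_.closure (A : Set M)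
  one_mem' := _root_.subset_closure A.one_mem
  mul_mem' := by
    intro p q hp hq
    refine closure_minimal (t := (· * q) ⁻¹' _root_.closure (A : Set M)) ?_
      (isClosed_closure.preimage (hR q)) hp
    intro a ha
    exact map_mem_closure (hL a ha) hq fun b hb => A.mul_mem ha hb

/-- An idempotent `u ∈ S` is minimal if it belongs to every left ideal `S p u`, that is, if the
left ideal `S u` is minimal. -/
structure IsMinimalIdempotent {M : Type*} [Monoid M] (S : Submonoid M) (u : M) : Prop where
  mem : u ∈ S
  mul_self : u * u = u
  exists_mul_eq : ∀ p ∈ S, ∃ q ∈ S, q * p * u = u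

section MinimalIdempotent

variable {M : Type*} [Monoid M] {S : Submonoid M} {u : M}

/-- If `u` is a minimal idempotent of `S`, then `u S u` is a group with neutral element `u`. -/
theorem IsMinimalIdempotent.exists_inverse (hu : IsMinimalIdempotent S u) {p : M} (hp : p ∈ S)
    (hpu : u * p * u = p) : ∃ q ∈ S, u * q * u = q ∧ q * p = u ∧ p * q = u := by
  have hup : u * p = p := by rw [← hpu]; simp only [← mul_assoc, hu.mul_self]
  have hpu' : p * u = p := by rw [← hpu]; simp only [mul_assoc, hu.mul_self]
  have key : ∀ p ∈ S, u * p = p → p * u = p →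
      ∃ q ∈ S, u * q = q ∧ q * u = q ∧ q * p = u := by
    intro p hp h1 h2
    obtain ⟨q, hq, h⟩ := hu.exists_mul_eq p hp
    refine ⟨u * q * u, S.mul_mem (S.mul_mem hu.mem hq) hu.mem, ?_, ?_, ?_⟩
    · simp only [← mul_assoc, hu.mul_self]
    · simp only [mul_assoc, hu.mul_self]
    · rw [mul_assoc, h1, mul_assoc, ← h2, ← mul_assoc q, h, hu.mul_self]
  obtain ⟨q, hq, h1, h2, h3⟩ := key p hp hup hpu'
  obtain ⟨s, -, -, h5, h6⟩ := key q hq h1 h2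
  refine ⟨q, hq, by rw [h1, h2], h3, ?_⟩
  have : s = p := by rw [← h5, ← h3, ← mul_assoc, h6, hup]
  rw [← this, h6]

/-- An idempotent `w = w u` below a minimal idempotent `u` satisfies `u w = u`, so that it
generates the same minimal left ideal. -/
theorem IsMinimalIdempotent.mul_eq_left (hu : IsMinimalIdempotent S u) {w : M} (hw : w ∈ S)
    (hww : w * w = w) (hwu : w * u = w) : u * w = u := by
  obtain ⟨q, -, h⟩ := hu.exists_mul_eq w hw
  rw [mul_assoc, hwu] at h
  rw [← h, mul_assoc, hww]

theorem IsMinimalIdempotent.of_mul_eq (hu : IsMinimalIdempotent S u) {w : M} (hw : w ∈ S)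
    (hww : w * w = w) (hwu : w * u = w) : IsMinimalIdempotent S w := by
  refine ⟨hw, hww, fun p hp => ?_⟩
  obtain ⟨q, hq, h⟩ := hu.exists_mul_eq (p * w) (S.mul_mem hp hw)
  refine ⟨w * q, S.mul_mem hw hq, ?_⟩
  rw [mul_assoc q, mul_assoc p, hwu] at h
  rw [mul_assoc w, mul_assoc w, mul_assoc q, h, hwu]

variable [TopologicalSpace M] [CompactSpace M] [T2Space M]

/-- Every closed left ideal `S r` contains an idempotent. -/
theorem exists_idempotent_mul_right (hR : ∀ r : M, Continuous (· * r)) (hS : IsClosed (S : Set M))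
    {r : M} (hr : r ∈ S) : ∃ p ∈ S, p * r * (p * r) = p * r := by
  obtain ⟨_, ⟨p, hp, rfl⟩, h⟩ := exists_idempotent_in_compact_subsemigroup hR
    ((· * r) '' (S : Set M)) ⟨_, 1, S.one_mem, rfl⟩ (hS.isCompact.image (hR r)) (by
      rintro _ ⟨p, hp, rfl⟩ _ ⟨q, hq, rfl⟩
      exact ⟨p * r * q, S.mul_mem (S.mul_mem hp hr) hq, by simp only [mul_assoc]⟩)
  exact ⟨p, hp, h⟩

theorem exists_isMinimalIdempotent (hR : ∀ r : M, Continuous (· * r))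
    (hS : IsClosed (S : Set M)) : ∃ u, IsMinimalIdempotent S u := by
  -- a minimal closed left ideal of `S`, from Zorn's lemma
  obtain ⟨L, hL⟩ : ∃ L, Minimal (· ∈ {L : Set M | IsClosed L ∧ L.Nonempty ∧ L ⊆ S ∧
      ∀ p ∈ S, ∀ q ∈ L, p * q ∈ L}) L := by
    refine zorn_superset _ fun c hcs hc => ?_
    rcases c.eq_empty_or_nonempty with rfl | hne
    · exact ⟨S, ⟨hS, ⟨1, S.one_mem⟩, subset_rfl, fun p hp q hq => S.mul_mem hp hq⟩, by simp⟩
    · refine ⟨⋂₀ c, ⟨isClosed_sInter fun s hs => (hcs hs).1, ?_, ?_, ?_⟩,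
        fun s hs => Set.sInter_subset_of_mem hs⟩
      · have : Nonempty c := hne.to_subtype
        exact IsCompact.nonempty_sInter_of_directed_nonempty_isCompact_isClosed
          (fun s hs t ht => (hc.total hs ht).elim (fun h => ⟨s, hs, subset_rfl, h⟩)
            fun h => ⟨t, ht, h, subset_rfl⟩) (fun s hs => (hcs hs).2.1)
          (fun s hs => (hcs hs).1.isCompact)
          (fun s hs => (hcs hs).1)
      · obtain ⟨s, hs⟩ := hne
        exact (Set.sInter_subset_of_mem hs).trans (hcs hs).2.2.1
      · exact fun p hp q hq s hs => (hcs hs).2.2.2 p hp q (hq s hs)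
  obtain ⟨hLc, hLne, hLS, hLmul⟩ := hL.prop
  obtain ⟨u, huL, huu⟩ := exists_idempotent_in_compact_subsemigroup hR L hLne hLc.isCompact
    fun p hp q hq => hLmul p (hLS hp) q hq
  refine ⟨u, hLS huL, huu, fun p hp => ?_⟩
  have hpu : p * u ∈ L := hLmul p hp u huL
  have hsub : (· * (p * u)) '' (S : Set M) ⊆ L := by
    rintro _ ⟨q, hq, rfl⟩
    exact hLmul q hq _ hpu
  obtain ⟨q, hq, h⟩ := hL.le_of_le ⟨(hS.isCompact.image (hR _)).isClosed,
    ⟨_, 1, S.one_mem, rfl⟩, hsub.trans hLS, by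
      rintro r hr _ ⟨q, hq, rfl⟩
      exact ⟨r * q, S.mul_mem hr hq, by simp only [mul_assoc]⟩⟩ hsub huL
  exact ⟨q, hq, by simpa only [mul_assoc] using h⟩

/-- A minimal idempotent `u` of `S` gives a minimal idempotent `(u, …, u)` of every closed
submonoid of a power of `M` which contains it and has its coordinates in `S`. -/
theorem IsMinimalIdempotent.pi_const (hu : IsMinimalIdempotent S u) {ι : Type*}
    {T : Submonoid (ι → M)} (hR : ∀ r : M, Continuous (· * r)) (hT : IsClosed (T : Set (ι → M)))
    (hTS : ∀ p ∈ T, ∀ i, p i ∈ S) (huT : (fun _ => u) ∈ T) :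
    IsMinimalIdempotent T (fun _ => u) := by
  refine ⟨huT, funext fun _ => hu.mul_self, fun p hp => ?_⟩
  have hR' : ∀ r : ι → M, Continuous (· * r) := fun r =>
    continuous_pi fun i => (hR (r i)).comp (continuous_apply i)
  have hr := T.mul_mem hp huT
  obtain ⟨q, hq, hv⟩ := exists_idempotent_mul_right hR' hT hr
  -- the idempotent `v = q p (u, …, u)` satisfies `u v_i = u` for every coordinate `i`
  refine ⟨(fun _ => u) * q, T.mul_mem huT hq, funext fun i => ?_⟩
  have h := hu.mul_eq_left (hTS _ (T.mul_mem hq hr) i) (congrFun hv i)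
    (by simp only [Pi.mul_apply, mul_assoc, hu.mul_self])
  simpa only [Pi.mul_apply, mul_assoc] using h

end MinimalIdempotent

/-! ### Enveloping semigroups -/

section Envelope

/-- Self-maps carry the topology of pointwise convergence. -/
instance Function.End.instTopologicalSpace {X : Type*} [TopologicalSpace X] :
    TopologicalSpace (Function.End X) :=
  inferInstanceAs (TopologicalSpace (X → X))

instance Function.End.instCompactSpace {X : Type*} [TopologicalSpace X] [CompactSpace X] :
    CompactSpace (Function.End X) :=
  inferInstanceAs (CompactSpace (X → X))

instance Function.End.instT2Space {X : Type*} [TopologicalSpace X] [T2Space X] :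
    T2Space (Function.End X) :=
  inferInstanceAs (T2Space (X → X))

variable {X : Type*} [TopologicalSpace X]

theorem Function.End.continuous_smul_right (x : X) :
    Continuous fun p : Function.End X => p • x :=
  continuous_apply (A := fun _ : X => X) x

theorem Function.End.continuous_mul_right (r : Function.End X) :
    Continuous fun p : Function.End X => p * r :=
  continuous_pi (A := fun _ : X => X) fun x => Function.End.continuous_smul_right (r x)

theorem Function.End.continuous_mul_left {a : Function.End X} (ha : Continuous (a • · : X → X)) :
    Continuous fun p : Function.End X => a * p :=
  continuous_pi (A := fun _ : X => X) fun x => ha.comp (Function.End.continuous_smul_right x)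

end Envelope

section Envelope

variable (G : Type*) [Group G] (X : Type*) [TopologicalSpace X] [MulAction G X]
  [ContinuousConstSMul G X]

/-- The enveloping (Ellis) semigroup of the system: the closure of the set of translations in the
space of self-maps of `X`, with the topology of pointwise convergence. -/
def envelope : Submonoid (Function.End X) :=
  (MonoidHom.mrange (MulAction.toEndHom : G →* Function.End X)).rightTopologicalClosure
    Function.End.continuous_mul_right (by
      rintro _ ⟨g, rfl⟩
      exact Function.End.continuous_mul_left (continuous_const_smul g))

/-- The enveloping semigroup of the action of the Host-Kra group on `X^{[n]}`, as a set of
families of self-maps of `X` indexed by the vertices of the cube. -/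
def cubeEnvelope (n : ℕ) : Submonoid (DCube n → Function.End X) :=
  ((hostKraGroup G n).toSubmonoid.map
    ((MulAction.toEndHom : G →* Function.End X).compLeft (DCube n))).rightTopologicalClosure
    (fun r => continuous_pi fun ω =>
      (Function.End.continuous_mul_right (r ω)).comp (continuous_apply ω)) (by
      rintro _ ⟨γ, -, rfl⟩
      exact continuous_pi fun ω => (Function.End.continuous_mul_left
        (continuous_const_smul (γ ω))).comp (continuous_apply ω))

theorem isClosed_envelope : IsClosed (envelope G X : Set (Function.End X)) := isClosed_closure

theorem isClosed_cubeEnvelope (n : ℕ) :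
    IsClosed (cubeEnvelope G X n : Set (DCube n → Function.End X)) := isClosed_closure

variable {G X}

theorem toEndHom_mem_envelope (g : G) :
    (MulAction.toEndHom g : Function.End X) ∈ envelope G X :=
  subset_closure ⟨g, rfl⟩

theorem compLeft_mem_cubeEnvelope {n : ℕ} {γ : DCube n → G} (hγ : γ ∈ hostKraGroup G n) :
    (fun ω => MulAction.toEndHom (γ ω) : DCube n → Function.End X) ∈ cubeEnvelope G X n :=
  subset_closure ⟨γ, hγ, rfl⟩

/-- Continuous maps which send the Host-Kra group into a closed set send its envelope there. -/
theorem cubeEnvelope_induction {n : ℕ} {Z : Type*} [TopologicalSpace Z]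
    {f : (DCube n → Function.End X) → Z} (hf : Continuous f) {s : Set Z} (hs : IsClosed s)
    (h : ∀ γ ∈ hostKraGroup G n, f (fun ω => MulAction.toEndHom (γ ω)) ∈ s)
    {p : DCube n → Function.End X} (hp : p ∈ cubeEnvelope G X n) : f p ∈ s := by
  refine closure_minimal (t := f ⁻¹' s) ?_ (hs.preimage hf) hp
  rintro _ ⟨γ, hγ, rfl⟩
  exact h γ hγ

theorem envelope_induction {Z : Type*} [TopologicalSpace Z]
    {f : Function.End X → Z} (hf : Continuous f) {s : Set Z} (hs : IsClosed s)
    (h : ∀ g : G, f (MulAction.toEndHom g) ∈ s)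
    {p : Function.End X} (hp : p ∈ envelope G X) : f p ∈ s := by
  refine closure_minimal (t := f ⁻¹' s) ?_ (hs.preimage hf) hp
  rintro _ ⟨g, rfl⟩
  exact h g

theorem apply_mem_envelope {n : ℕ} {p : DCube n → Function.End X} (hp : p ∈ cubeEnvelope G X n)
    (ω : DCube n) : p ω ∈ envelope G X :=
  cubeEnvelope_induction (continuous_apply ω) (isClosed_envelope G X)
    (fun γ _ => toEndHom_mem_envelope (γ ω)) hp

theorem const_mem_cubeEnvelope {n : ℕ} {p : Function.End X} (hp : p ∈ envelope G X) :
    (fun _ => p) ∈ cubeEnvelope G X (n + 1) :=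
  envelope_induction (f := fun (p : Function.End X) (_ : DCube (n + 1)) => p) (by fun_prop)
    (isClosed_cubeEnvelope G X (n + 1))
    (fun g => compLeft_mem_cubeEnvelope (const_mem_hostKraGroup n g)) hp

theorem mulIndicator_hyperface_mem_cubeEnvelope {n : ℕ} (i : Fin n) (a : Bool)
    {p : Function.End X} (hp : p ∈ envelope G X) :
    (hyperface i a).mulIndicator (fun _ => p) ∈ cubeEnvelope G X n := by
  classical
  refine envelope_induction
    (f := fun p : Function.End X => (hyperface i a).mulIndicator (fun _ => p)) ?_
    (isClosed_cubeEnvelope G X n) (fun g => ?_) hp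
  · refine continuous_pi fun ω => ?_
    by_cases h : ω ∈ hyperface i a
    · simpa [Set.mulIndicator, h] using continuous_id'
    · simpa [Set.mulIndicator, h] using continuous_const
  · have hγ : faceElement (hyperface i a) g ∈ hostKraGroup G n :=
      Subgroup.subset_closure ⟨i, a, g, rfl⟩
    have heq : (hyperface i a).mulIndicator (fun _ => (MulAction.toEndHom g : Function.End X)) =
        fun ω => MulAction.toEndHom (faceElement (hyperface i a) g ω) := by
      funext ω
      by_cases h : ω ∈ hyperface i a <;> simp [faceElement, Set.mulIndicator, h]
    rw [heq]
    exact compLeft_mem_cubeEnvelope hγ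

/-- The envelopes are compatible with morphisms of discrete cubes. -/
theorem comp_mem_cubeEnvelope {n k : ℕ} {f : DCube (n + 1) → DCube k} (hf : IsDCubeMorphism f)
    {p : DCube k → Function.End X} (hp : p ∈ cubeEnvelope G X k) :
    p ∘ f ∈ cubeEnvelope G X (n + 1) :=
  cubeEnvelope_induction (f := fun p : DCube k → Function.End X => p ∘ f)
    (continuous_pi fun ω => continuous_apply (f ω)) (isClosed_cubeEnvelope G X (n + 1))
    (fun γ hγ => compLeft_mem_cubeEnvelope (comp_mem_hostKraGroup f hf γ hγ)) hp

/-- For an idempotent `w` of the envelope, the family equal to the identity at the vertex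
`(1, …, 1)` and to `w` elsewhere belongs to the envelope of the Host-Kra group: it is the product
of the elements `[w]_F`, where `F` runs over the faces `{ω | ω i = 0}`. -/
theorem ite_topVertex_mem_cubeEnvelope {n : ℕ} {w : Function.End X} (hw : w ∈ envelope G X)
    (hww : w * w = w) [DecidableEq (DCube n)] :
    (fun ω => if ω = topVertex n then 1 else w) ∈ cubeEnvelope G X n := by
  have key : ∀ J : Finset (Fin n),
      (fun ω : DCube n => if ∃ i ∈ J, ω i = false then w else 1) ∈ cubeEnvelope G X n := by
    intro J
    induction J using Finset.induction_on with
    | empty =>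
      simp only [Finset.notMem_empty, false_and, exists_false, if_false]
      exact (cubeEnvelope G X n).one_mem
    | insert j J _ ih =>
      convert (cubeEnvelope G X n).mul_mem
        (mulIndicator_hyperface_mem_cubeEnvelope j false hw) ih using 1
      funext ω
      by_cases h1 : ω j = false <;> by_cases h2 : ∃ i ∈ J, ω i = false <;>
        simp [Set.mulIndicator, hyperface, h1, h2, hww]
  convert key Finset.univ using 1
  funext ω
  by_cases h : ω = topVertex n
  · simp [h, topVertex]
  · have : ∃ i, ω i = false := by
      by_contra! h'
      exact h (funext fun i => by simpa [topVertex] using h' i)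
    simp [h, this]

end Envelope

/-! ### Minimal systems -/

section Minimal

variable {G : Type*} [Group G] {X : Type*} [TopologicalSpace X] [MulAction G X]

theorem const_mem_dynamicalCubes (n : ℕ) (x : X) : (fun _ => x) ∈ dynamicalCubes G X n :=
  subset_closure ⟨1, one_mem _, x, by simp⟩

theorem comp_mem_dynamicalCubes {r k : ℕ} {f : DCube r → DCube k} (hf : IsDCubeMorphism f)
    {c : DCube k → X} (hc : c ∈ dynamicalCubes G X k) : c ∘ f ∈ dynamicalCubes G X r :=
  (dynamicalCubespace G X).cube_invariance f hf c hc

variable [ContinuousConstSMul G X]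

/-- The envelope of the Host-Kra group acts on the dynamical cubes. -/
theorem smul_mem_dynamicalCubes {n : ℕ} {p : DCube n → Function.End X}
    (hp : p ∈ cubeEnvelope G X n) {c : DCube n → X} (hc : c ∈ dynamicalCubes G X n) :
    p • c ∈ dynamicalCubes G X n := by
  refine cubeEnvelope_induction (f := fun p : DCube n → Function.End X => p • c)
    (continuous_pi fun ω => (Function.End.continuous_smul_right (c ω)).comp (continuous_apply ω))
    isClosed_closure (fun γ hγ => ?_) hp
  refine map_mem_closure (f := fun c : DCube n → X => fun ω => γ ω • c ω)
    (continuous_pi fun ω => (continuous_apply ω).const_smul _) hc ?_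
  rintro _ ⟨δ, hδ, x, rfl⟩
  exact ⟨γ * δ, mul_mem hγ hδ, x, funext fun ω => by simp [mul_smul]⟩

variable [CompactSpace X] [T2Space X] [MulAction.IsMinimal G X]

theorem exists_envelope_smul_eq (x y : X) : ∃ p ∈ envelope G X, p • x = y := by
  have hcl : IsClosed ((fun p : Function.End X => p • x) '' (envelope G X : Set _)) :=
    ((isClosed_envelope G X).isCompact.image (Function.End.continuous_smul_right x)).isClosed
  refine hcl.closure_subset_iff.2 ?_ (MulAction.dense_orbit G x y)
  rintro _ ⟨g, rfl⟩
  exact ⟨_, toEndHom_mem_envelope g, rfl⟩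

/-- Every dynamical cube belongs to the orbit closure of every constant cube. -/
theorem exists_cubeEnvelope_smul_const_eq {n : ℕ} (x : X) {c : DCube (n + 1) → X}
    (hc : c ∈ dynamicalCubes G X (n + 1)) :
    ∃ p ∈ cubeEnvelope G X (n + 1), (p • fun _ => x) = c := by
  have hcont : Continuous fun p : DCube (n + 1) → Function.End X => p • fun _ => x :=
    continuous_pi fun ω => (Function.End.continuous_smul_right x).comp
      (continuous_apply (A := fun _ => Function.End X) ω)
  refine ((isClosed_cubeEnvelope G X (n + 1)).isCompact.image
    hcont).isClosed.closure_subset_iff.2 ?_ hc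
  rintro _ ⟨γ, hγ, y, rfl⟩
  obtain ⟨p, hp, rfl⟩ := exists_envelope_smul_eq (G := G) x y
  exact ⟨_, mul_mem (compLeft_mem_cubeEnvelope hγ) (const_mem_cubeEnvelope hp),
    funext fun ω => rfl⟩

/-- Every point of a minimal system is fixed by a minimal idempotent `w` which generates the same
minimal left ideal as a given one `u`. -/
theorem IsMinimalIdempotent.exists_fixing {u : Function.End X}
    (hu : IsMinimalIdempotent (envelope G X) u) (x : X) :
    ∃ w, IsMinimalIdempotent (envelope G X) w ∧ w * u = w ∧ w • x = x := by
  obtain ⟨p, hp, hpx⟩ := exists_envelope_smul_eq (G := G) (u • x) x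
  let T : Set (Function.End X) := (· * u) '' (envelope G X : Set _) ∩ {w | w • x = x}
  have hcl : IsClosed T :=
    ((isClosed_envelope G X).isCompact.image
      (Function.End.continuous_mul_right u)).isClosed.inter
      (isClosed_eq (Function.End.continuous_smul_right x) continuous_const)
  obtain ⟨_, ⟨⟨w, hw, rfl⟩, hwx⟩, hww⟩ := exists_idempotent_in_compact_subsemigroup
    Function.End.continuous_mul_right T
    ⟨p * u, ⟨p, hp, rfl⟩, show (p * u) • x = x by rw [mul_smul, hpx]⟩
    hcl.isCompact (by
      rintro _ ⟨⟨q, hq, rfl⟩, h1⟩ _ ⟨⟨r, hr, rfl⟩, h2⟩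
      refine ⟨⟨q * u * r, mul_mem (mul_mem hq hu.mem) hr, by simp only [mul_assoc]⟩, ?_⟩
      change (q * u * (r * u)) • x = x
      rw [mul_smul, show (r * u) • x = x from h2, show (q * u) • x = x from h1])
  have hmem := mul_mem hw hu.mem
  have hwu : w * u * u = w * u := by rw [mul_assoc, hu.mul_self]
  exact ⟨w * u, hu.of_mul_eq hmem hww hwu, hwu, hwx⟩

/-- The group `U E U` with `U = (u, …, u)`, restricted to its elements with the coordinate `u` at
the vertex `b`, connects every cube `c` fixed by `U` with the constant cube `c b`. -/
theorem IsMinimalIdempotent.exists_smul_const_eq {u : Function.End X}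
    (hu : IsMinimalIdempotent (envelope G X) u) {n : ℕ} {c : DCube (n + 1) → X}
    (hc : c ∈ dynamicalCubes G X (n + 1)) (huc : ∀ ω, u • c ω = c ω) (b : DCube (n + 1)) :
    ∃ r ∈ cubeEnvelope G X (n + 1), ∃ q ∈ cubeEnvelope G X (n + 1),
      r b = u ∧ (r • fun _ => c b) = c ∧
      (∀ ω, u * q ω = q ω) ∧ q b = u ∧ (q • c) = fun _ => c b := by
  set U : DCube (n + 1) → Function.End X := fun _ => u with hUdef
  have hUmem : U ∈ cubeEnvelope G X (n + 1) := const_mem_cubeEnvelope hu.mem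
  have hU : IsMinimalIdempotent (cubeEnvelope G X (n + 1)) U :=
    hu.pi_const Function.End.continuous_mul_right (isClosed_cubeEnvelope G X (n + 1))
      (fun p hp ω => apply_mem_envelope hp ω) hUmem
  obtain ⟨p, hp, hpc⟩ := exists_cubeEnvelope_smul_const_eq (G := G) (c b) hc
  have hpω : ∀ ω, p ω • c b = c ω := fun ω => congrFun hpc ω
  -- divide `U p U` by its coordinate `u p_b u` at `b`, an element of the group `u E u` fixing `c b`
  obtain ⟨g, hg, hug, hgp, hpg⟩ := hu.exists_inverse
    (mul_mem (mul_mem hu.mem (apply_mem_envelope hp b)) hu.mem)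
    (by simp only [← mul_assoc, hu.mul_self]; simp only [mul_assoc, hu.mul_self])
  have hgb : g • c b = c b := by
    have h : (u * p b * u) • c b = c b := by simp only [mul_smul, huc, hpω]
    calc g • c b = (g * (u * p b * u)) • c b := by rw [mul_smul g, h]
      _ = c b := by rw [hgp, huc]
  have hug' : u * g = g := by rw [← hug]; simp only [← mul_assoc, hu.mul_self]
  have hgu' : g * u = g := by rw [← hug]; simp only [mul_assoc, hu.mul_self]
  have hr : U * p * (fun _ => g) ∈ cubeEnvelope G X (n + 1) :=
    mul_mem (mul_mem hUmem hp) (const_mem_cubeEnvelope hg)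
  have hrb : (U * p * fun _ => g : DCube (n + 1) → Function.End X) b = u := by
    simp only [Pi.mul_apply, hUdef]
    rw [← hug', ← mul_assoc]
    exact hpg
  have hrc : ((U * p * fun _ => g : DCube (n + 1) → Function.End X) • fun _ => c b) = c := by
    funext ω
    simp only [Pi.smul_apply', Pi.mul_apply, mul_smul, hgb, hpω, hUdef, huc]
  obtain ⟨q, hq, huq, hqr, -⟩ := hU.exists_inverse hr (by
    funext ω
    simp only [Pi.mul_apply, hUdef, mul_assoc, hgu']
    rw [← mul_assoc u u, hu.mul_self])
  have hquω : ∀ ω, q ω * u = q ω := fun ω => by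
    rw [← huq]; simp only [Pi.mul_apply, hUdef, mul_assoc, hu.mul_self]
  refine ⟨_, hr, q, hq, hrb, hrc, fun ω => ?_, ?_, ?_⟩
  · rw [← huq]; simp only [Pi.mul_apply, hUdef, ← mul_assoc, hu.mul_self]
  · rw [← hquω b]
    nth_rw 1 [← hrb]
    exact congrFun hqr b
  · conv_lhs => rw [← hrc]
    rw [← mul_smul, hqr]
    funext ω
    exact huc b

end Minimal

/-! ### Morphisms of discrete cubes -/

theorem isDCubeMorphism_update_false {n : ℕ} (j : Fin n) :
    IsDCubeMorphism fun ω : DCube n => Function.update ω j false := by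
  intro k
  rcases eq_or_ne k j with rfl | h
  · exact Or.inl fun ω => by simp
  · exact Or.inr (Or.inr (Or.inl ⟨k, fun ω => by simp [h]⟩))

theorem isDCubeMorphism_removeNth {n : ℕ} (i : Fin (n + 1)) :
    IsDCubeMorphism fun ω : DCube (n + 1) => (i.removeNth ω : DCube n) :=
  fun k => Or.inr (Or.inr (Or.inl ⟨i.succAbove k, fun _ => rfl⟩))

theorem isDCubeMorphism_cons_true (n : ℕ) :
    IsDCubeMorphism fun ω : DCube n => (Fin.cons true ω : DCube (n + 1)) := by
  intro k
  induction k using Fin.cases with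
  | zero => exact Or.inr (Or.inl fun ω => rfl)
  | succ k => exact Or.inr (Or.inr (Or.inl ⟨k, fun ω => rfl⟩))

/-- A reflection of the cube which moves the vertex `b` to `(1, …, 1)`. -/
theorem exists_reflection {n : ℕ} (b : DCube n) :
    ∃ f : DCube n → DCube n, IsDCubeMorphism f ∧ ∀ ω, f ω = topVertex n ↔ ω = b := by
  refine ⟨fun ω i => if b i then ω i else !ω i, fun k => ?_, fun ω => ?_⟩
  · cases h : b k
    · exact Or.inr (Or.inr (Or.inr ⟨k, fun ω => by simp [h]⟩))
    · exact Or.inr (Or.inr (Or.inl ⟨k, fun ω => by simp [h]⟩))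
  · simp only [funext_iff, topVertex]
    refine forall_congr' fun i => ?_
    cases b i <;> simp

theorem exists_ne_topVertex (n : ℕ) : ∃ ω : DCube (n + 1), ω ≠ topVertex (n + 1) :=
  ⟨fun _ => false, fun h => by simpa [topVertex] using congrFun h 0⟩

/-! ### The relation of order `d` is an equivalence relation -/

@[simp]
theorem lowerCorner_topVertex {X : Type*} (n : ℕ) (x y : X) :
    lowerCorner n x y (topVertex n) = y := if_pos rfl

theorem lowerCorner_of_ne {X : Type*} {n : ℕ} (x y : X) {ω : DCube n} (h : ω ≠ topVertex n) :
    lowerCorner n x y ω = x := if_neg h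

theorem smul_lowerCorner {X : Type*} {u : Function.End X} {n : ℕ} {x y : X}
    (hx : u • x = x) (hy : u • y = y) (ω : DCube n) :
    u • lowerCorner n x y ω = lowerCorner n x y ω := by
  by_cases hω : ω = topVertex n
  · rw [hω, lowerCorner_topVertex, hy]
  · rw [lowerCorner_of_ne x y hω, hx]

section NRP

variable {G : Type*} [Group G] {X : Type*} [TopologicalSpace X] [MulAction G X] {d : ℕ}

theorem mem_NRP_of_cube {c : DCube (d + 1) → X} (hc : c ∈ dynamicalCubes G X (d + 1)) {x y : X}
    (hx : ∀ ω, ω ≠ topVertex (d + 1) → c ω = x) (hy : c (topVertex (d + 1)) = y) :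
    (x, y) ∈ NRP G X d := by
  have h : c = lowerCorner (d + 1) x y := by
    funext ω
    by_cases hω : ω = topVertex (d + 1)
    · rw [hω, hy, lowerCorner_topVertex]
    · rw [hx ω hω, lowerCorner_of_ne x y hω]
  rwa [h] at hc

theorem mem_NRP_self (x : X) : (x, x) ∈ NRP G X d :=
  mem_NRP_of_cube (const_mem_dynamicalCubes (d + 1) x) (fun _ _ => rfl) rfl

theorem isClosed_NRP : IsClosed (NRP G X d) := by
  refine (isClosed_closure (s := hostKraOrbits G X (d + 1))).preimage
    (f := fun p : X × X => lowerCorner (d + 1) p.1 p.2) (continuous_pi fun ω => ?_)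
  by_cases h : ω = topVertex (d + 1)
  · simpa only [h, lowerCorner_topVertex] using continuous_snd
  · simpa only [lowerCorner_of_ne _ _ h] using continuous_fst

theorem NRP_succ_subset : NRP G X (d + 1) ⊆ NRP G X d := by
  rintro ⟨x, y⟩ h
  have h' := comp_mem_dynamicalCubes (isDCubeMorphism_cons_true (d + 1)) h
  have htop : (Fin.cons true (topVertex (d + 1)) : DCube (d + 1 + 1)) = topVertex (d + 1 + 1) := by
    funext i
    induction i using Fin.cases <;> rfl
  refine mem_NRP_of_cube h' (fun ω hω => ?_) ?_
  · refine lowerCorner_of_ne _ _ fun h => hω ?_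
    rw [← htop] at h
    exact Fin.cons_right_injective _ h
  · simp only [Function.comp_apply, htop, lowerCorner_topVertex]

theorem NRP_antitone : Antitone fun d => NRP G X d :=
  antitone_nat_of_succ_le fun _ => NRP_succ_subset

variable [ContinuousConstSMul G X]

theorem envelope_smul_mem_NRP {p : Function.End X} (hp : p ∈ envelope G X) {x y : X}
    (h : (x, y) ∈ NRP G X d) : (p • x, p • y) ∈ NRP G X d := by
  have h' := smul_mem_dynamicalCubes (const_mem_cubeEnvelope hp) h
  refine mem_NRP_of_cube h' (fun ω hω => ?_) ?_
  · simp only [Pi.smul_apply', lowerCorner_of_ne _ _ hω]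
  · simp only [Pi.smul_apply', lowerCorner_topVertex]

variable [CompactSpace X] [T2Space X] [MulAction.IsMinimal G X]

/-- The first point of a pair in `NRP` may be replaced by a point which is proximal to it: if `w`
fixes `x` and `w u = w`, then applying `w` away from `(1, …, 1)` takes `u x` to `x`. -/
theorem IsMinimalIdempotent.mem_NRP_of_smul_left {u : Function.End X}
    (hu : IsMinimalIdempotent (envelope G X) u) {x y : X} (h : (u • x, y) ∈ NRP G X d) :
    (x, y) ∈ NRP G X d := by
  classical
  obtain ⟨w, hw, hwu, hwx⟩ := hu.exists_fixing x
  have h' := smul_mem_dynamicalCubes (ite_topVertex_mem_cubeEnvelope hw.mem hw.mul_self) h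
  refine mem_NRP_of_cube h' (fun ω hω => ?_) ?_
  · simp only [Pi.smul_apply', lowerCorner_of_ne _ _ hω, if_neg hω]
    rw [← mul_smul, hwu, hwx]
  · simp only [Pi.smul_apply', lowerCorner_topVertex, if_true, one_smul]

theorem NRP_symm {x y : X} (h : (x, y) ∈ NRP G X d) : (y, x) ∈ NRP G X d := by
  obtain ⟨u₀, hu₀⟩ := exists_isMinimalIdempotent (S := envelope G X)
    Function.End.continuous_mul_right (isClosed_envelope G X)
  obtain ⟨u, hu, -, hux⟩ := hu₀.exists_fixing x
  -- it suffices to treat the almost periodic pair `(x, u y)`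
  refine hu.mem_NRP_of_smul_left ?_
  have h₁ := envelope_smul_mem_NRP hu.mem h
  rw [hux] at h₁
  have huy : u • u • y = u • y := by rw [← mul_smul, hu.mul_self]
  obtain ⟨-, -, q, hq, -, -, -, hqt, hqc⟩ := hu.exists_smul_const_eq h₁
    (smul_lowerCorner hux huy) (topVertex (d + 1))
  have h' := smul_mem_dynamicalCubes hq (const_mem_dynamicalCubes (G := G) (d + 1) x)
  refine mem_NRP_of_cube h' (fun ω hω => ?_) ?_
  · have := congrFun hqc ω
    rwa [Pi.smul_apply', lowerCorner_of_ne _ _ hω, lowerCorner_topVertex] at this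
  · rw [Pi.smul_apply', hqt, hux]

theorem NRP_trans {x y z : X} (hxy : (x, y) ∈ NRP G X d) (hyz : (y, z) ∈ NRP G X d) :
    (x, z) ∈ NRP G X d := by
  obtain ⟨u, hu⟩ := exists_isMinimalIdempotent (S := envelope G X)
    Function.End.continuous_mul_right (isClosed_envelope G X)
  have huu : ∀ t : X, u • u • t = u • t := fun t => by rw [← mul_smul, hu.mul_self]
  suffices h : (u • x, u • z) ∈ NRP G X d from
    NRP_symm (hu.mem_NRP_of_smul_left (NRP_symm (hu.mem_NRP_of_smul_left h)))
  have h₁ := envelope_smul_mem_NRP hu.mem hxy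
  obtain ⟨r, hr, -, -, hrt, hrc, -⟩ := hu.exists_smul_const_eq h₁
    (smul_lowerCorner (huu x) (huu y)) (topVertex (d + 1))
  have h' := smul_mem_dynamicalCubes hr (envelope_smul_mem_NRP hu.mem hyz)
  refine mem_NRP_of_cube h' (fun ω hω => ?_) ?_
  · have := congrFun hrc ω
    rw [Pi.smul_apply', lowerCorner_of_ne _ _ hω, lowerCorner_topVertex] at this
    simpa only [Pi.smul_apply', lowerCorner_of_ne _ _ hω] using this
  · simp only [Pi.smul_apply', lowerCorner_topVertex, hrt, huu]

variable (G X d) in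
theorem equivalence_NRP : Equivalence fun x y : X => (x, y) ∈ NRP G X d :=
  ⟨mem_NRP_self, NRP_symm, NRP_trans⟩

end NRP

/-! ### Systems with trivial relation are nilspaces -/

section Distal

variable {G : Type*} [Group G] {X : Type*} [TopologicalSpace X] [MulAction G X] {d : ℕ}

theorem NRP_eq_diagonal_of_hasUniqueness (h : (dynamicalCubespace G X).HasUniqueness (d + 1)) :
    NRP G X d = Set.diagonal X := by
  ext ⟨x, y⟩
  refine ⟨fun hxy => ?_, fun hxy => ?_⟩
  · have := h _ hxy _ (const_mem_dynamicalCubes (d + 1) x) fun ω hω => lowerCorner_of_ne x y hω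
    simpa using (congrFun this (topVertex (d + 1))).symm
  · obtain rfl : x = y := hxy
    exact mem_NRP_self x

theorem isSystemOfOrderAtMost_of_NRP_eq {k : ℕ} (hk : 1 ≤ k) (hkd : k ≤ d)
    (h : NRP G X k = Set.diagonal X) : IsSystemOfOrderAtMost G X d := by
  classical
  have hex : ∃ k, 1 ≤ k ∧ NRP G X k = Set.diagonal X := ⟨k, hk, h⟩
  exact ⟨Nat.find hex, (Nat.find_min' hex ⟨hk, h⟩).trans hkd, Nat.find_spec hex,
    fun m hm => Nat.find_min' hex hm⟩

variable [ContinuousConstSMul G X] [CompactSpace X] [T2Space X]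

theorem exists_inverse_cubeEnvelope (h : IsMinimalIdempotent (envelope G X) 1) {n : ℕ}
    {p : DCube (n + 1) → Function.End X} (hp : p ∈ cubeEnvelope G X (n + 1)) :
    ∃ q ∈ cubeEnvelope G X (n + 1), q * p = 1 := by
  have hU : IsMinimalIdempotent (cubeEnvelope G X (n + 1)) 1 :=
    h.pi_const Function.End.continuous_mul_right (isClosed_cubeEnvelope G X (n + 1))
      (fun p hp ω => apply_mem_envelope hp ω) (one_mem _)
  obtain ⟨q, hq, -, hqp, -⟩ := hU.exists_inverse hp (by simp)
  exact ⟨q, hq, hqp⟩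

variable [MulAction.IsMinimal G X]

/-- A minimal system is ergodic, since the Host-Kra group in dimension one is `G × G`. -/
theorem isErgodic_dynamicalCubespace : (dynamicalCubespace G X).IsErgodic := by
  refine Set.eq_univ_of_forall fun c => ?_
  obtain ⟨p, hp, hpc⟩ :=
    exists_envelope_smul_eq (G := G) (c fun _ => false) (c (topVertex 1))
  have h := smul_mem_dynamicalCubes (mulIndicator_hyperface_mem_cubeEnvelope (0 : Fin 1) true hp)
    (const_mem_dynamicalCubes (G := G) 1 (c fun _ => false))
  change c ∈ dynamicalCubes G X 1
  convert h using 1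
  funext ω
  rw [Pi.smul_apply']
  cases hω : ω 0
  · have : ω = fun _ => false := funext fun i => by rw [Subsingleton.elim i 0, hω]
    simp [Set.mulIndicator, hyperface, this]
  · have : ω = topVertex 1 := funext fun i => by rw [Subsingleton.elim i 0, hω]; rfl
    simp [Set.mulIndicator, hyperface, this, topVertex, ← hpc]

/-- If `NRP` is trivial, the system is distal: a minimal idempotent moves every point to a proximal
one, hence is the identity, and the envelope is a group. -/
theorem isMinimalIdempotent_one (h : NRP G X d = Set.diagonal X) :
    IsMinimalIdempotent (envelope G X) 1 := by
  obtain ⟨u, hu⟩ := exists_isMinimalIdempotent (S := envelope G X)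
    Function.End.continuous_mul_right (isClosed_envelope G X)
  have : u = 1 := by
    funext x
    have hx : (x, u • x) ∈ NRP G X d := hu.mem_NRP_of_smul_left (mem_NRP_self (u • x))
    rw [h] at hx
    exact (show x = u • x from hx).symm
  rwa [this] at hu

theorem hasUniqueness_of_NRP_eq (h : NRP G X d = Set.diagonal X) :
    (dynamicalCubespace G X).HasUniqueness (d + 1) := by
  intro c hc c' hc' hcc'
  obtain ⟨-, -, q, hq, -, -, -, hqt, hqc⟩ := (isMinimalIdempotent_one h).exists_smul_const_eq hc
    (fun ω => one_smul _ _) (topVertex (d + 1))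
  have h' := smul_mem_dynamicalCubes hq hc'
  have htop : (c (topVertex (d + 1)), c' (topVertex (d + 1))) ∈ NRP G X d := by
    refine mem_NRP_of_cube h' (fun ω hω => ?_) ?_
    · rw [Pi.smul_apply', ← hcc' ω hω]
      exact congrFun hqc ω
    · rw [Pi.smul_apply', hqt, one_smul]
  rw [h] at htop
  funext ω
  by_cases hω : ω = topVertex (d + 1)
  · rw [hω]
    exact htop
  · exact hcc' ω hω

/-- In a distal system, a cube with the constant value `x` on the faces `{ω | ω i = 0}`, `i ∈ J`,
is moved to the constant cube by an element of the envelope which is trivial on these faces. -/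
theorem exists_smul_eq_const_of_eq_on_faces (h : IsMinimalIdempotent (envelope G X) 1) {n : ℕ}
    {c : DCube (n + 1) → X} (hc : c ∈ dynamicalCubes G X (n + 1)) (J : Finset (Fin (n + 1))) {x : X}
    (hx : c (fun _ => false) = x) (hJ : ∀ ω, (∃ i ∈ J, ω i = false) → c ω = x) :
    ∃ r ∈ cubeEnvelope G X (n + 1), (∀ ω, r ω • c ω = x) ∧
      ∀ ω, (∃ i ∈ J, ω i = false) → r ω = 1 := by
  induction J using Finset.induction_on with
  | empty =>
    obtain ⟨-, -, q, hq, -, -, -, -, hqc⟩ := h.exists_smul_const_eq hc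
      (fun ω => one_smul _ _) (fun _ => false)
    exact ⟨q, hq, fun ω => (congrFun hqc ω).trans hx, by simp⟩
  | insert j J _ ih =>
    obtain ⟨r, hr, hrc, hr1⟩ := ih fun ω ⟨i, hi, h⟩ => hJ ω ⟨i, Finset.mem_insert_of_mem hi, h⟩
    -- `r'` copies the face `ω j = 0` of `r` to the opposite face; it fixes the constant cube
    have hr' := comp_mem_cubeEnvelope (isDCubeMorphism_update_false j) hr
    set r' : DCube (n + 1) → Function.End X :=
      r ∘ fun ω : DCube (n + 1) => Function.update ω j false with hr'def
    have hr'ω : ∀ ω, r' ω = r (Function.update ω j false) := fun ω => rfl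
    obtain ⟨t, ht, htr⟩ := exists_inverse_cubeEnvelope h hr'
    have htrω : ∀ ω, t ω * r' ω = 1 := fun ω => congrFun htr ω
    refine ⟨t * r, mul_mem ht hr, fun ω => ?_, ?_⟩
    · have h1 : r' ω • x = x := by
        have h2 := hrc (Function.update ω j false)
        rwa [hJ _ ⟨j, Finset.mem_insert_self j J, by simp⟩] at h2
      rw [Pi.mul_apply, mul_smul, hrc]
      conv_lhs => rw [← h1]
      rw [← mul_smul, htrω, one_smul]
    · rintro ω ⟨i, hi, hω⟩
      rcases Finset.mem_insert.1 hi with rfl | hi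
      · have h1 : r' ω = r ω := by rw [hr'ω, ← hω, Function.update_eq_self]
        rw [Pi.mul_apply, ← h1, htrω]
      · have h1 : r ω = 1 := hr1 ω ⟨i, hi, hω⟩
        have h2 : r' ω = 1 := hr1 _ ⟨i, hi, by by_cases hij : i = j <;> simp [hij, hω]⟩
        have h3 := htrω ω
        rw [h2, mul_one] at h3
        rw [Pi.mul_apply, h1, h3, one_mul]

/-- In a distal system, a configuration whose faces `{ω | ω i = 0}` are cubes can be made constant
on any number of these faces by an element of the envelope. -/
theorem exists_smul_eq_on_faces (h : IsMinimalIdempotent (envelope G X) 1) {n : ℕ}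
    {c : DCube (n + 1) → X}
    (hc : ∀ i, (fun ω => c (Function.update ω i false)) ∈ dynamicalCubes G X (n + 1))
    (J : Finset (Fin (n + 1))) :
    ∃ s ∈ cubeEnvelope G X (n + 1), s (fun _ => false) • c (fun _ => false) = c (fun _ => false) ∧
      ∀ ω, (∃ i ∈ J, ω i = false) → s ω • c ω = c (fun _ => false) := by
  induction J using Finset.induction_on with
  | empty => exact ⟨1, one_mem _, one_smul _ _, by simp⟩
  | insert j J _ ih =>
    obtain ⟨s, hs, hs0, hsJ⟩ := ih
    have hf := isDCubeMorphism_update_false j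
    have hface := smul_mem_dynamicalCubes (comp_mem_cubeEnvelope hf hs) (hc j)
    have hzero : Function.update (fun _ => false : DCube (n + 1)) j false = fun _ => false :=
      Function.update_eq_self _ _
    have hupd : ∀ {ω : DCube (n + 1)} {i}, ω i = false → Function.update ω j false i = false := by
      intro ω i hω
      by_cases hij : i = j <;> simp [hij, hω]
    obtain ⟨r, hr, hrc, hr1⟩ := exists_smul_eq_const_of_eq_on_faces h hface J
      (x := c fun _ => false)
      (by simpa only [Pi.smul_apply', Function.comp_apply, hzero] using hs0)
      (fun ω ⟨i, hi, hω⟩ => hsJ _ ⟨i, hi, hupd hω⟩)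
    have key : ∀ ω : DCube (n + 1), ω j = false →
        (r (Function.update ω j false) * s ω) • c ω = c fun _ => false := by
      intro ω hω
      have h1 := hrc ω
      have h2 : Function.update ω j false = ω := by rw [← hω, Function.update_eq_self]
      simp only [Pi.smul_apply', Function.comp_apply, h2] at h1
      rw [h2, mul_smul, h1]
    refine ⟨_, mul_mem (comp_mem_cubeEnvelope hf hr) hs, key _ rfl, ?_⟩
    rintro ω ⟨i, hi, hω⟩
    rcases Finset.mem_insert.1 hi with rfl | hi
    · exact key ω hω
    · have h1 : r (Function.update ω j false) = 1 := hr1 _ ⟨i, hi, hupd hω⟩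
      rw [Pi.mul_apply, Function.comp_apply, h1, one_mul]
      exact hsJ ω ⟨i, hi, hω⟩

/-- Distal minimal systems are fibrant: a corner is moved to a constant one, which is completed by
a constant cube. -/
theorem isFibrant_dynamicalCubespace (h : IsMinimalIdempotent (envelope G X) 1) :
    (dynamicalCubespace G X).IsFibrant := by
  classical
  intro n f hf
  obtain ⟨ω₀, hω₀⟩ := exists_ne_topVertex n
  -- an extension of the corner by an irrelevant value at `(1, …, 1)`
  let c : DCube (n + 1) → X := fun ω =>
    if hω : ω ≠ topVertex (n + 1) then f ⟨ω, hω⟩ else f ⟨ω₀, hω₀⟩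
  have hc : ∀ i, (fun ω => c (Function.update ω i false)) ∈ dynamicalCubes G X (n + 1) := by
    intro i
    convert comp_mem_dynamicalCubes (isDCubeMorphism_removeNth i) (hf i) using 1
    funext ω
    have hω : Function.update ω i false = i.insertNth false (i.removeNth ω) :=
      (Fin.insertNth_removeNth i false ω).symm
    have hne := insertNth_false_ne_topVertex i (i.removeNth ω)
    simp only [c, hω, Function.comp_apply, dif_pos hne]
  obtain ⟨s, hs, -, hsc⟩ := exists_smul_eq_on_faces h hc Finset.univ
  obtain ⟨t, ht, hts⟩ := exists_inverse_cubeEnvelope h hs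
  refine ⟨_, smul_mem_dynamicalCubes ht (const_mem_dynamicalCubes (n + 1) (c fun _ => false)), ?_⟩
  rintro ⟨ω, hω⟩
  have hex : ∃ i ∈ Finset.univ, ω i = false := by
    by_contra! h'
    exact hω (funext fun i => by simpa [topVertex] using h' i (Finset.mem_univ i))
  rw [Pi.smul_apply', ← hsc ω hex, ← mul_smul, show t ω * s ω = 1 from congrFun hts ω, one_smul]
  exact dif_pos hω

/-- A minimal system has order at most `d` if and only if its dynamical cubespace is an ergodic
nilspace of order at most `d`. -/
theorem isSystemOfOrderAtMost_iff (hd : 1 ≤ d) :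
    IsSystemOfOrderAtMost G X d ↔
      (dynamicalCubespace G X).IsErgodic ∧
        (dynamicalCubespace G X).IsNilspaceOfOrderAtMost d := by
  classical
  refine ⟨?_, ?_⟩
  · rintro ⟨k, hkd, ⟨-, hk⟩, -⟩
    have hex : ∃ k, (dynamicalCubespace G X).HasUniqueness (k + 1) :=
      ⟨k, hasUniqueness_of_NRP_eq hk⟩
    exact ⟨isErgodic_dynamicalCubespace, Nat.find hex,
      (Nat.find_min' hex (hasUniqueness_of_NRP_eq hk)).trans hkd,
      isFibrant_dynamicalCubespace (isMinimalIdempotent_one hk), Nat.find_spec hex,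
      fun m hm => Nat.find_min' hex hm⟩
  · rintro ⟨-, k, hkd, -, hk, -⟩
    refine isSystemOfOrderAtMost_of_NRP_eq hd le_rfl (Set.Subset.antisymm ?_ ?_)
    · exact (NRP_antitone hkd).trans (NRP_eq_diagonal_of_hasUniqueness hk).subset
    · rintro ⟨x, y⟩ hxy
      obtain rfl : x = y := hxy
      exact mem_NRP_self x

end Distal

/-! ### Factors -/

section Factor

variable {G : Type*} [Group G] {X Y : Type*} [TopologicalSpace X] [MulAction G X]
  [TopologicalSpace Y] [MulAction G Y] {φ : X → Y}

theorem IsFactorMap.comp_mem_dynamicalCubes (hφ : IsFactorMap G φ) {n : ℕ} {c : DCube n → X}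
    (hc : c ∈ dynamicalCubes G X n) : φ ∘ c ∈ dynamicalCubes G Y n := by
  refine map_mem_closure (f := fun c : DCube n → X => φ ∘ c)
    (continuous_pi fun ω => hφ.continuous.comp (continuous_apply ω)) hc ?_
  rintro _ ⟨γ, hγ, x, rfl⟩
  exact ⟨γ, hγ, φ x, funext fun ω => hφ.map_smul _ _⟩

theorem IsFactorMap.exists_comp_eq [CompactSpace X] [T2Space Y] (hφ : IsFactorMap G φ) {n : ℕ}
    {c : DCube n → Y} (hc : c ∈ dynamicalCubes G Y n) :
    ∃ c' ∈ dynamicalCubes G X n, φ ∘ c' = c := by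
  have hcont : Continuous fun c : DCube n → X => φ ∘ c :=
    continuous_pi fun ω => hφ.continuous.comp (continuous_apply ω)
  have hcl := ((isClosed_closure (s := hostKraOrbits G X n)).isCompact.image hcont).isClosed
  refine hcl.closure_subset_iff.2 ?_ hc
  rintro _ ⟨γ, hγ, y, rfl⟩
  obtain ⟨x, rfl⟩ := hφ.surjective y
  exact ⟨_, subset_closure ⟨γ, hγ, x, rfl⟩, funext fun ω => hφ.map_smul _ _⟩

theorem IsFactorMap.map_mem_NRP (hφ : IsFactorMap G φ) {d : ℕ} {x y : X}
    (h : (x, y) ∈ NRP G X d) : (φ x, φ y) ∈ NRP G Y d :=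
  mem_NRP_of_cube (hφ.comp_mem_dynamicalCubes h)
    (fun _ hω => congrArg φ (lowerCorner_of_ne x y hω)) (congrArg φ (lowerCorner_topVertex _ x y))

theorem IsFactorMap.isMinimal [MulAction.IsMinimal G X] (hφ : IsFactorMap G φ) :
    MulAction.IsMinimal G Y := by
  refine ⟨fun y => ?_⟩
  obtain ⟨x, rfl⟩ := hφ.surjective y
  refine (hφ.surjective.denseRange.dense_image hφ.continuous
    (MulAction.dense_orbit G x)).mono ?_
  rintro _ ⟨_, ⟨g, rfl⟩, rfl⟩
  exact ⟨g, (hφ.map_smul g x).symm⟩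

end Factor

/-! ### The quotient by the relation of order `d` -/

/-- The quotient of a compact Hausdorff space by a closed equivalence relation is Hausdorff. -/
theorem Equivalence.t2Space_quot {X : Type*} [TopologicalSpace X] [CompactSpace X] [T2Space X]
    {R : X → X → Prop} (hR : Equivalence R) (hcl : IsClosed {p : X × X | R p.1 p.2}) :
    T2Space (Quot R) := by
  have hmk : ∀ {x y : X}, Quot.mk R x = Quot.mk R y ↔ R x y := hR.quot_mk_eq_iff _ _
  -- saturations of closed sets are closed
  have hclosed : IsClosedMap (Quot.mk R) := by
    intro A hA
    rw [← isQuotientMap_quot_mk.isClosed_preimage]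
    convert ((hcl.inter (hA.preimage continuous_fst)).isCompact.image continuous_snd).isClosed
      using 1
    ext y
    constructor
    · rintro ⟨x, hx, hxy⟩
      exact ⟨(x, y), ⟨hmk.1 hxy, hx⟩, rfl⟩
    · rintro ⟨⟨x, y⟩, ⟨hxy, hx⟩, rfl⟩
      exact ⟨x, hx, hmk.2 hxy⟩
  refine ⟨fun p q hpq => ?_⟩
  have hfib : ∀ p : Quot R, IsClosed (Quot.mk R ⁻¹' {p}) := by
    intro p
    obtain ⟨x, rfl⟩ := Quot.exists_rep p
    have := (hclosed {x} isClosed_singleton).preimage continuous_quot_mk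
    rwa [Set.image_singleton] at this
  obtain ⟨U, V, hU, hV, hpU, hqV, hUV⟩ := normal_separation (hfib p) (hfib q)
    (Disjoint.preimage _ (Set.disjoint_singleton.2 hpq))
  refine ⟨_, _, isClosedMap_iff_kernImage.1 hclosed hU, isClosedMap_iff_kernImage.1 hclosed hV,
    fun x hx => hpU hx, fun x hx => hqV hx, Set.disjoint_left.2 fun r hrU hrV => ?_⟩
  obtain ⟨x, rfl⟩ := Quot.exists_rep r
  exact Set.disjoint_left.1 hUV (hrU rfl) (hrV rfl)

section Quotient

variable {G : Type*} [Group G] {X : Type*} [TopologicalSpace X] [MulAction G X] {d : ℕ}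

instance [CompactSpace X] : CompactSpace (NRPQuotient G X d) :=
  inferInstanceAs (CompactSpace (Quot _))

theorem isFactorMap_nrpProj [ContinuousConstSMul G X] : IsFactorMap G (nrpProj G X d) :=
  ⟨continuous_quot_mk, Quot.exists_rep, fun _ _ => rfl⟩

variable [CompactSpace X] [T2Space X] [MulAction.IsMinimal G X]

instance [ContinuousConstSMul G X] : T2Space (NRPQuotient G X d) :=
  (equivalence_NRP G X d).t2Space_quot isClosed_NRP

instance [TopologicalSpace G] [ContinuousSMul G X] : ContinuousSMul G (NRPQuotient G X d) := by
  have hπ : IsFactorMap G (nrpProj G X d) := isFactorMap_nrpProj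
  -- the projection is proper, hence stays a quotient map after multiplication by `G`
  have hq : Topology.IsQuotientMap (Prod.map id (nrpProj G X d) : G × X → _) :=
    ((isProperMap_id.prodMap hπ.continuous.isProperMap).isClosedMap).isQuotientMap
      (continuous_id.prodMap hπ.continuous) (Function.surjective_id.prodMap hπ.surjective)
  refine ⟨hq.continuous_iff.2 ?_⟩
  exact hπ.continuous.comp continuous_smul

variable [ContinuousConstSMul G X]

theorem nrpProj_eq_iff {x y : X} : nrpProj G X d x = nrpProj G X d y ↔ (x, y) ∈ NRP G X d :=
  (equivalence_NRP G X d).quot_mk_eq_iff x y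

/-- For cubes fixed by a minimal idempotent, a coordinate may be replaced by an `NRP`-equivalent
point. -/
theorem IsMinimalIdempotent.update_mem_dynamicalCubes {u : Function.End X}
    (hu : IsMinimalIdempotent (envelope G X) u) {c : DCube (d + 1) → X}
    (hc : c ∈ dynamicalCubes G X (d + 1)) (huc : ∀ ω, u • c ω = c ω) (b : DCube (d + 1)) {z : X}
    (hz : u • z = z) (hbz : (c b, z) ∈ NRP G X d) [DecidableEq (DCube (d + 1))] :
    Function.update c b z ∈ dynamicalCubes G X (d + 1) := by
  -- move the pair to a corner at `b`, and apply an element taking the constant cube `c b` to `c`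
  obtain ⟨f, hf, hfb⟩ := exists_reflection b
  obtain ⟨r, hr, -, -, hrb, hrc, -⟩ := hu.exists_smul_const_eq hc huc b
  convert smul_mem_dynamicalCubes hr (comp_mem_dynamicalCubes hf hbz) using 1
  funext ω
  rw [Pi.smul_apply', Function.comp_apply]
  rcases eq_or_ne ω b with rfl | hω
  · rw [(hfb ω).2 rfl, lowerCorner_topVertex, hrb, hz, Function.update_self]
  · rw [lowerCorner_of_ne _ _ (mt (hfb ω).1 hω), Function.update_of_ne hω]
    exact (congrFun hrc ω).symm

theorem IsMinimalIdempotent.mem_dynamicalCubes_of_NRP {u : Function.End X}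
    (hu : IsMinimalIdempotent (envelope G X) u) {c c' : DCube (d + 1) → X}
    (hc : c ∈ dynamicalCubes G X (d + 1)) (huc : ∀ ω, u • c ω = c ω) (huc' : ∀ ω, u • c' ω = c' ω)
    (h : ∀ ω, (c ω, c' ω) ∈ NRP G X d) : c' ∈ dynamicalCubes G X (d + 1) := by
  classical
  have key : ∀ s : Finset (DCube (d + 1)), s.piecewise c' c ∈ dynamicalCubes G X (d + 1) := by
    intro s
    induction s using Finset.induction_on with
    | empty => rwa [Finset.piecewise_empty]
    | insert b s hb ih =>
      rw [Finset.piecewise_insert]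
      refine hu.update_mem_dynamicalCubes ih (fun ω => ?_) b (huc' b) ?_
      · by_cases hω : ω ∈ s <;> simp [hω, huc, huc']
      · rw [Finset.piecewise_eq_of_notMem _ _ _ hb]
        exact h b
  simpa using key Finset.univ

/-- The relation of order `d` is trivial on the quotient `X / NRP`. -/
theorem NRP_nrpQuotient_eq_diagonal : NRP G (NRPQuotient G X d) d = Set.diagonal _ := by
  ext ⟨y₁, y₂⟩
  refine ⟨fun h => ?_, fun h => ?_⟩
  swap
  · obtain rfl : y₁ = y₂ := h
    exact mem_NRP_self y₁
  have hπ : IsFactorMap G (nrpProj G X d) := isFactorMap_nrpProj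
  obtain ⟨u, hu⟩ := exists_isMinimalIdempotent (S := envelope G X)
    Function.End.continuous_mul_right (isClosed_envelope G X)
  have huu : ∀ t : X, u • u • t = u • t := fun t => by rw [← mul_smul, hu.mul_self]
  -- `u` moves points inside their classes, so that the lift `c` may be taken fixed by `u`
  have hproj : ∀ t : X, nrpProj G X d (u • t) = nrpProj G X d t := fun t =>
    (nrpProj_eq_iff.2 (hu.mem_NRP_of_smul_left (mem_NRP_self (u • t)))).symm
  obtain ⟨c₀, hc₀, hc₀y⟩ := hπ.exists_comp_eq h
  have hc := smul_mem_dynamicalCubes (const_mem_cubeEnvelope hu.mem) hc₀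
  set c : DCube (d + 1) → X :=
    (fun _ => u : DCube (d + 1) → Function.End X) • c₀ with hcdef
  have huc : ∀ ω, u • c ω = c ω := fun ω => huu (c₀ ω)
  have hcy : ∀ ω, nrpProj G X d (c ω) = lowerCorner (d + 1) y₁ y₂ ω := fun ω =>
    (hproj (c₀ ω)).trans (congrFun hc₀y ω)
  obtain ⟨ω₁, hω₁⟩ := exists_ne_topVertex d
  set x₁ := c ω₁ with hx₁
  set x₂ := c (topVertex (d + 1)) with hx₂
  have hx₁y : nrpProj G X d x₁ = y₁ := (hcy ω₁).trans (lowerCorner_of_ne _ _ hω₁)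
  have hx₂y : nrpProj G X d x₂ = y₂ := (hcy _).trans (lowerCorner_topVertex _ _ _)
  -- `q` takes `c` to the constant `x₂`, hence the constant `x₁` to a cube equivalent to a corner
  obtain ⟨-, -, q, hq, -, -, huq, hqt, hqc⟩ := hu.exists_smul_const_eq hc huc (topVertex _)
  have hcorner : (x₂, x₁) ∈ NRP G X d := by
    refine hu.mem_dynamicalCubes_of_NRP (c' := lowerCorner (d + 1) x₂ x₁)
      (smul_mem_dynamicalCubes hq (const_mem_dynamicalCubes (d + 1) x₁)) (fun ω => ?_)
      (smul_lowerCorner (huc _) (huc _)) fun ω => ?_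
    · rw [Pi.smul_apply', ← mul_smul, huq]
    · rw [Pi.smul_apply']
      by_cases hω : ω = topVertex (d + 1)
      · rw [hω, hqt, lowerCorner_topVertex, hx₁, huc]
        exact mem_NRP_self _
      · have h1 : q ω • c ω = x₂ := congrFun hqc ω
        rw [lowerCorner_of_ne _ _ hω, ← h1]
        refine envelope_smul_mem_NRP (apply_mem_envelope hq ω) (nrpProj_eq_iff.1 ?_)
        rw [hx₁y, hcy, lowerCorner_of_ne _ _ hω]
  have h12 := nrpProj_eq_iff.2 hcorner
  rw [hx₁y, hx₂y] at h12
  exact h12.symm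

end Quotient

theorem mainTheorem6 (G : Type u) [Group G] [TopologicalSpace G]
    [IsTopologicalGroup G] [T2Space G]
    (X : Type v) [TopologicalSpace X] [CompactSpace X] [T2Space X]
    [MulAction G X] [ContinuousSMul G X] [MulAction.IsMinimal G X]
    (d : ℕ) (hd : 1 ≤ d) :
    -- a minimal system has order at most `d` iff it is an ergodic nilspace of order at most `d`
    (IsSystemOfOrderAtMost G X d ↔
      (dynamicalCubespace G X).IsErgodic ∧ (dynamicalCubespace G X).IsNilspaceOfOrderAtMost d) ∧
    -- `NRP^{[d]}(X)` is a closed invariant equivalence relation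
    (Equivalence (fun x y : X => (x, y) ∈ NRP G X d) ∧ IsClosed (NRP G X d) ∧
      ∀ (g : G) (x y : X), (x, y) ∈ NRP G X d → (g • x, g • y) ∈ NRP G X d) ∧
    -- `X / NRP^{[d]}(X)` is a minimal system and a factor of `X`
    (CompactSpace (NRPQuotient G X d) ∧ T2Space (NRPQuotient G X d) ∧
      ContinuousSMul G (NRPQuotient G X d) ∧ MulAction.IsMinimal G (NRPQuotient G X d) ∧
      IsFactorMap G (nrpProj G X d)) ∧
    -- it is an ergodic nilspace of order at most `d`
    ((dynamicalCubespace G (NRPQuotient G X d)).IsErgodic ∧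
      (dynamicalCubespace G (NRPQuotient G X d)).IsNilspaceOfOrderAtMost d) ∧
    -- every factor of `X` which is an ergodic nilspace of order at most `d` factors through it
    (∀ (Y : Type w) [TopologicalSpace Y] [CompactSpace Y] [T2Space Y]
      [MulAction G Y] [ContinuousSMul G Y] (φ : X → Y), IsFactorMap G φ →
      (dynamicalCubespace G Y).IsErgodic → (dynamicalCubespace G Y).IsNilspaceOfOrderAtMost d →
      ∃ ψ : NRPQuotient G X d → Y, IsFactorMap G ψ ∧ φ = ψ ∘ nrpProj G X d) := by

  have hπ : IsFactorMap G (nrpProj G X d) := isFactorMap_nrpProj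
  have hmin : MulAction.IsMinimal G (NRPQuotient G X d) := hπ.isMinimal
  refine ⟨isSystemOfOrderAtMost_iff hd,
    ⟨equivalence_NRP G X d, isClosed_NRP, fun g _ _ => smul_mem_NRP G X d g⟩,
    ⟨inferInstance, inferInstance, inferInstance, hmin, hπ⟩,
    (isSystemOfOrderAtMost_iff hd).1
      (isSystemOfOrderAtMost_of_NRP_eq hd le_rfl NRP_nrpQuotient_eq_diagonal), ?_⟩
  rintro Y _ _ _ _ _ φ hφ - ⟨k, hkd, -, hk, -⟩
  have hlift : ∀ x y : X, (x, y) ∈ NRP G X d → φ x = φ y := fun x y h =>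
    (NRP_eq_diagonal_of_hasUniqueness hk).subset (NRP_antitone hkd (hφ.map_mem_NRP h))
  refine ⟨Quot.lift φ hlift, ⟨continuous_quot_lift hlift hφ.continuous, fun y => ?_, ?_⟩, rfl⟩
  · obtain ⟨x, rfl⟩ := hφ.surjective y
    exact ⟨nrpProj G X d x, rfl⟩
  · rintro g ⟨x⟩
    exact hφ.map_smul g x
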